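/- Let $q\ge 6$ be a prime power. In $\mathrm{PG}(6,q)$ let $\mathcal C=\{(1,\theta,\theta^2)\mid\theta\in\mathbb F_q\cup\{\infty\}\}$ be a non-degenerate conic, written in coordinates of a plane $\alpha$, and let $\mathcal N=\{(1,\epsilon,\epsilon^2,\epsilon^3)\mid\epsilon\in\mathbb F_q\cup\{\infty\}\}$ be a twisted cubic, written in coordinates of a $3$-space $\Pi_3$ with $\alpha\cap\Pi_3=\emptyset$. Let $\phi\in\mathrm{PGL}(2,q)$ act on the parameters $\mathbb F_q\cup\{\infty\}$. Let $\mathcal V$ be the ruled quintic surface consisting of all points on the $q+1$ lines joining the point of $\mathcal C$ with parameter $\theta$ to the point of $\mathcal N$ with parameter $\phi(\theta)$, $\theta\in\mathbb F_q\cup\{\infty\}$. These lines are called the generators of $\mathcal V$, and $\mathcal C$ its conic directrix. An $r$-dimensional normal rational curve (nrc) is a set of points $\{(1,\theta,\dots,\theta^r)\mid\theta\in\mathbb F_q\cup\{\infty\}\}$, written in coordinates of some $r$-space of $\mathrm{PG}(6,q)$ (with $\theta=\infty$ giving $(0,\dots,0,1)$). Say that a $5$-space $\Pi$ meets $\mathcal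 V$ in a point set $N$ and $i$ generators if $\Pi$ contains exactly $i$ generators and $\Pi\cap\mathcal V$ is the union of $N$ and these $i$ generators. Then every $5$-space of $\mathrm{PG}(6,q)$ meets $\mathcal V$ in one of the following: (a) a $5$-dimensional nrc (and no generators); (b) a $4$-dimensional nrc and $0$ or $1$ generators; (c) a $3$-dimensional nrc (a twisted cubic) and $0$, $1$ or $2$ generators; (d) the conic directrix $\mathcal C$ and $0$, $1$, $2$ or $3$ generators. -/

import Mathlib

open scoped LinearAlgebra.Projectivization MatrixGroups

noncomputable section

/-- The vector `(s ^ r, s ^ (r - 1) * t, …, t ^ r)` attached to the pair `(s, t)`. -/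
def veroneseVec {F : Type*} [Field F] (r : ℕ) (v : Fin 2 → F) : Fin (r + 1) → F :=
  fun i => v 0 ^ (r - (i : ℕ)) * v 1 ^ (i : ℕ)

theorem veroneseVec_ne_zero {F : Type*} [Field F] (r : ℕ) {v : Fin 2 → F} (hv : v ≠ 0) :
    veroneseVec r v ≠ 0 := by
  intro h
  by_cases h0 : v 0 = 0
  · have h1 : v 1 ≠ 0 := by
      intro h1
      apply hv
      funext i
      fin_cases i
      · exact h0
      · exact h1
    have h2 := congrFun h (Fin.last r)
    simp [veroneseVec] at h2
    exact h1 h2.1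
  · have h2 := congrFun h 0
    simp [veroneseVec] at h2
    exact h0 h2.1

theorem veroneseVec_smul {F : Type*} [Field F] (r : ℕ) (c : F) (v : Fin 2 → F) :
    veroneseVec r (c • v) = c ^ r • veroneseVec r v := by
  funext i
  have hc : c ^ r = c ^ (r - (i : ℕ)) * c ^ (i : ℕ) := by
    rw [← pow_add]
    congr 1
    omega
  simp only [veroneseVec, Pi.smul_apply, smul_eq_mul, mul_pow]
  rw [hc]
  ring

/-- The parametrisation of the standard normal rational curve of `PG(r, F)` by the projective
line.  With `θ = t / s` the non-homogeneous parameter of the point `(s : t)`, it sends `θ` to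
`(1, θ, …, θ ^ r)`, and `∞` to `(0, …, 0, 1)`. -/
def veronese {F : Type*} [Field F] (r : ℕ) :
    ℙ F (Fin 2 → F) → ℙ F (Fin (r + 1) → F) :=
  Projectivization.lift
    (fun v => Projectivization.mk F (veroneseVec r v.1) (veroneseVec_ne_zero r v.2))
    (fun a b c h => by
      rw [Projectivization.mk_eq_mk_iff']
      exact ⟨c ^ r, by rw [h, veroneseVec_smul]⟩)

/-- The projective space `PG(6, F)`. -/
abbrev PG6 (F : Type*) [Field F] := ℙ F (Fin 7 → F)

/-- The subspaces of `PG(6, F)`. -/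
abbrev PG6.Sub (F : Type*) [Field F] := Projectivization.Subspace F (Fin 7 → F)

/-- `S` is an `r`-space, that is, a subspace of projective dimension `r`. -/
def IsRSpace {F : Type*} [Field F] (r : ℕ) (S : PG6.Sub F) : Prop :=
  Module.finrank F (Projectivization.Subspace.submodule S) = r + 1

/-- `N` is an `r`-dimensional normal rational curve of `PG(6, F)`: the set of points
`(1, θ, …, θ ^ r)`, `θ ∈ F ∪ {∞}`, with respect to a coordinate frame of some `r`-space. -/
def IsNRC {F : Type*} [Field F] (r : ℕ) (N : Set (PG6 F)) : Prop :=
  ∃ (L : (Fin (r + 1) → F) →ₗ[F] (Fin 7 → F)) (hL : Function.Injective L),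
    N = Set.range (fun p => Projectivization.map L hL (veronese r p))

/-- The data of a scroll of `PG(6, F)` that rules a non-degenerate conic and a twisted cubic
according to a projectivity: a coordinate frame of a plane `α` in which the conic is
`{(1, θ, θ²)}`, a coordinate frame of a `3`-space disjoint from `α` in which the twisted cubic is
`{(1, ε, ε², ε³)}`, and an element of `PGL(2, F)` acting on the parameters. -/
structure RuledQuintic (F : Type*) [Field F] where
  conicFrame : (Fin 3 → F) →ₗ[F] (Fin 7 → F)
  conicFrame_injective : Function.Injective conicFrame
  cubicFrame : (Fin 4 → F) →ₗ[F] (Fin 7 → F)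
  cubicFrame_injective : Function.Injective cubicFrame
  disjoint_frames : Disjoint (LinearMap.range conicFrame) (LinearMap.range cubicFrame)
  projectivity : PGL(2, F)

namespace RuledQuintic

/-- The point of the conic directrix with a given parameter. -/
def conicPoint {F : Type*} [Field F] (V : RuledQuintic F) (p : ℙ F (Fin 2 → F)) : PG6 F :=
  Projectivization.map V.conicFrame V.conicFrame_injective (veronese 2 p)

/-- The point of the twisted cubic directrix with a given parameter. -/
def cubicPoint {F : Type*} [Field F] (V : RuledQuintic F) (p : ℙ F (Fin 2 → F)) : PG6 F :=
  Projectivization.map V.cubicFrame V.cubicFrame_injective (veronese 3 p)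

/-- The conic directrix. -/
def conic {F : Type*} [Field F] (V : RuledQuintic F) : Set (PG6 F) :=
  Set.range V.conicPoint

/-- The line joining a point of the conic to the corresponding point of the twisted cubic. -/
def generator {F : Type*} [Field F] (V : RuledQuintic F) (p : ℙ F (Fin 2 → F)) : PG6.Sub F :=
  Projectivization.Subspace.span {V.conicPoint p, V.cubicPoint (V.projectivity • p)}

/-- The point set of the surface: all points on the generators. -/
def points {F : Type*} [Field F] (V : RuledQuintic F) : Set (PG6 F) :=
  ⋃ p, (V.generator p : Set (PG6 F))

/-- The set of generators of the surface that lie in the subspace `S`. -/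
def generatorsIn {F : Type*} [Field F] (V : RuledQuintic F) (S : PG6.Sub F) :
    Set (PG6.Sub F) :=
  {l | l ∈ Set.range V.generator ∧ l ≤ S}

/-- The subspace `S` meets the surface in the point set `N` and `i` generators: exactly `i`
generators lie in `S`, and the intersection is the union of `N` and these generators. -/
def MeetsIn {F : Type*} [Field F] (V : RuledQuintic F) (S : PG6.Sub F) (N : Set (PG6 F))
    (i : ℕ) : Prop :=
  (V.generatorsIn S).encard = i ∧
    (S : Set (PG6 F)) ∩ V.points = N ∪ ⋃ l ∈ V.generatorsIn S, (l : Set (PG6 F))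

end RuledQuintic

end

noncomputable section

namespace RuledQuintic
open Polynomial

/-! Absorb the projectivity into the frame of the cubic, so that the generator with parameter v
joins C(v) on the conic to N(v) on the cubic. Restricting the equation of a hyperplane to these
curves gives binary forms f of degree 2 and c of degree 3, and x C(v) + y N(v) lies in the
hyperplane iff x f(v) + y c(v) = 0. If f = 0, the conic is contained, c is nonzero, and its zeros
give at most three generators. Otherwise f = d p and c = d q with p, q coprime and d of degree k ≤
2: the zeros of d give the generators contained, and any other generator meets the hyperplane only
in q(v) C(v) - p(v) N(v).

These points trace a curve of degree 5 - k. It is the image of the standard normal rational curve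
under a linear map, and this map is injective because p times the forms of degree 3 and q times the
forms of degree 2 together span all forms of degree 5 - k (`FormsCoprime.exists_mul_add_mul`,
`SectionData.residual_injective`).

A form is stored as a polynomial with a formal degree; for a nonzero form, the drop in degree is its
multiplicity of vanishing at infinity. -/

/-! ### Evaluation and zeros of binary forms. -/

/-- The linear functional `∑ pᵢ Xⁱ ↦ ∑ pᵢ cᵢ` attached to a coefficient vector `c`. -/
def coeffPairing {F : Type*} [Field F] {n : ℕ} (c : Fin (n + 1) → F) : F[X] →ₗ[F] F :=
  ∑ i : Fin (n + 1), c i • lcoeff F i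

theorem coeffPairing_apply {F : Type*} [Field F] {n : ℕ} (c : Fin (n + 1) → F) (p : F[X]) :
    coeffPairing c p = ∑ i : Fin (n + 1), p.coeff i * c i := by
  simp [coeffPairing, mul_comm]

theorem coeffPairing_X_pow {F : Type*} [Field F] {n : ℕ} (c : Fin (n + 1) → F)
    (i : Fin (n + 1)) : coeffPairing c (X ^ (i : ℕ)) = c i := by
  rw [coeffPairing_apply, Finset.sum_eq_single i]
  · simp
  · intro j _ hj
    rw [coeff_X_pow, if_neg (fun h => hj (Fin.ext h)), zero_mul]
  · simp

/-- The value at `v` of the binary form of degree `n` with dehomogenisation `p`. -/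
def homEval {F : Type*} [Field F] (n : ℕ) (p : F[X]) (v : Fin 2 → F) : F :=
  coeffPairing (veroneseVec n v) p

theorem homEval_of_ne_zero {F : Type*} [Field F] {n : ℕ} {p : F[X]} (hp : p.natDegree ≤ n)
    {v : Fin 2 → F} (hv : v 0 ≠ 0) : homEval n p v = v 0 ^ n * p.eval (v 1 / v 0) := by
  rw [homEval, coeffPairing_apply, eval_eq_sum_range' (Nat.lt_succ_of_le hp), Finset.mul_sum,
    ← Fin.sum_univ_eq_sum_range (fun i => v 0 ^ n * (p.coeff i * (v 1 / v 0) ^ i)) (n + 1)]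
  refine Finset.sum_congr rfl fun i _ => ?_
  have hi : v 0 ^ n = v 0 ^ (n - (i : ℕ)) * v 0 ^ (i : ℕ) := by
    rw [← pow_add]
    congr 1
    omega
  rw [hi, veroneseVec, div_pow]
  field_simp

theorem homEval_of_eq_zero {F : Type*} [Field F] (n : ℕ) (p : F[X])
    {v : Fin 2 → F} (hv : v 0 = 0) : homEval n p v = p.coeff n * v 1 ^ n := by
  rw [homEval, coeffPairing_apply, Finset.sum_eq_single (Fin.last n)]
  · simp [veroneseVec]
  · intro i _ hi
    have : (i : ℕ) ≠ n := fun h => hi (Fin.ext h)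
    have : n - (i : ℕ) ≠ 0 := by omega
    simp [veroneseVec, hv, this]
  · simp

theorem homEval_mul {F : Type*} [Field F] {m n : ℕ} {p q : F[X]} (hp : p.natDegree ≤ m)
    (hq : q.natDegree ≤ n) (v : Fin 2 → F) :
    homEval (m + n) (p * q) v = homEval m p v * homEval n q v := by
  by_cases hv : v 0 = 0
  · rw [homEval_of_eq_zero _ _ hv, homEval_of_eq_zero _ _ hv, homEval_of_eq_zero _ _ hv,
      coeff_mul_add_eq_of_natDegree_le hp hq]
    ring
  · rw [homEval_of_ne_zero (natDegree_mul_le_of_le hp hq) hv, homEval_of_ne_zero hp hv,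
      homEval_of_ne_zero hq hv, eval_mul]
    ring

/-- A nonzero binary form of degree `n` has at most `n` zeros on the projective line. -/
theorem encard_zeros_le {F : Type*} [Field F] {n : ℕ} {p : F[X]} (hp : p.natDegree ≤ n)
    (h0 : p ≠ 0) : {x : ℙ F (Fin 2 → F) | homEval n p x.rep = 0}.encard ≤ n := by
  classical
  have hne : ∀ t : F, ![1, t] ≠ 0 := fun t h => by simpa using congrFun h 0
  have hinf : ![(0 : F), 1] ≠ 0 := fun h => by simpa using congrFun h 1
  let A : Set (ℙ F (Fin 2 → F)) :=
    (fun t => Projectivization.mk F ![1, t] (hne t)) '' (p.roots.toFinset : Set F)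
  have hA : A.encard ≤ p.natDegree := by
    refine (Set.encard_image_le _ _).trans ?_
    rw [Set.encard_coe_eq_coe_finsetCard]
    exact_mod_cast (Multiset.toFinset_card_le _).trans (card_roots' p)
  have hfin : ∀ x : ℙ F (Fin 2 → F), homEval n p x.rep = 0 → x.rep 0 ≠ 0 → x ∈ A := by
    intro x hx hx0
    refine ⟨x.rep 1 / x.rep 0, ?_, ?_⟩
    · rw [homEval_of_ne_zero hp hx0] at hx
      simpa [h0, hx0] using hx
    · conv_rhs => rw [← x.mk_rep]
      rw [Projectivization.mk_eq_mk_iff']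
      refine ⟨(x.rep 0)⁻¹, ?_⟩
      ext i
      fin_cases i
      · simp [hx0]
      · simp
        field_simp
  -- Infinity is a zero exactly when the coefficient of degree `n` vanishes; the degree then drops,
  -- which leaves room for the extra zero.
  by_cases hc : p.coeff n = 0
  · have hlt : p.natDegree < n := by
      refine lt_of_le_of_ne hp fun h => h0 ?_
      rwa [← h, coeff_natDegree, leadingCoeff_eq_zero] at hc
    refine (Set.encard_le_encard (t := insert (Projectivization.mk F _ hinf) A) ?_).trans ?_
    · intro x hx
      by_cases hx0 : x.rep 0 = 0
      · left
        conv_lhs => rw [← x.mk_rep]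
        rw [Projectivization.mk_eq_mk_iff']
        refine ⟨x.rep 1, ?_⟩
        ext i
        fin_cases i <;> simp [hx0]
      · exact Or.inr (hfin x hx hx0)
    · refine (Set.encard_insert_le _ _).trans ?_
      calc A.encard + 1 ≤ (p.natDegree : ℕ∞) + 1 := by gcongr
        _ ≤ n := by exact_mod_cast hlt
  · refine (Set.encard_le_encard (t := A) ?_).trans (hA.trans (by exact_mod_cast hp))
    intro x hx
    refine hfin x hx fun hx0 => ?_
    have hx' : homEval n p x.rep = 0 := hx
    rw [homEval_of_eq_zero _ _ hx0] at hx'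
    have h1 : x.rep 1 = 0 := by
      rcases mul_eq_zero.1 hx' with h | h
      · exact absurd h hc
      · exact eq_zero_of_pow_eq_zero h
    exact x.rep_nonzero (by ext i; fin_cases i <;> simp [hx0, h1])

/-! ### Coprime binary forms and Bézout with degree bounds. -/

/-- Binary forms `p`, `q` of degrees `m`, `n`, given by their dehomogenisations, have no common
factor. -/
structure FormsCoprime {F : Type*} [Field F] (m n : ℕ) (p q : F[X]) : Prop where
  natDegree_left : p.natDegree ≤ m
  natDegree_right : q.natDegree ≤ n
  isCoprime : IsCoprime p q
  coeff_ne_zero : p.coeff m ≠ 0 ∨ q.coeff n ≠ 0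

theorem FormsCoprime.symm {F : Type*} [Field F] {m n : ℕ} {p q : F[X]}
    (h : FormsCoprime m n p q) : FormsCoprime n m q p :=
  ⟨h.2, h.1, h.3.symm, h.4.symm⟩

theorem FormsCoprime.homEval_ne_zero {F : Type*} [Field F] {m n : ℕ} {p q : F[X]}
    (h : FormsCoprime m n p q) {v : Fin 2 → F} (hv : v ≠ 0) :
    homEval m p v ≠ 0 ∨ homEval n q v ≠ 0 := by
  by_cases hv0 : v 0 = 0
  · have hv1 : v 1 ≠ 0 := fun h1 => hv (by ext i; fin_cases i <;> simp [hv0, h1])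
    rw [homEval_of_eq_zero _ _ hv0, homEval_of_eq_zero _ _ hv0]
    simpa [hv1] using h.coeff_ne_zero
  · rw [homEval_of_ne_zero h.natDegree_left hv0, homEval_of_ne_zero h.natDegree_right hv0]
    obtain ⟨a, b, hab⟩ := h.isCoprime
    by_contra! hcon
    have h1 : p.eval (v 1 / v 0) = 0 := by simpa [hv0] using hcon.1
    have h2 : q.eval (v 1 / v 0) = 0 := by simpa [hv0] using hcon.2
    simpa [h1, h2] using congrArg (eval (v 1 / v 0)) hab

/-- In g = p(ga) + q(gb), reduce gb modulo p to get w of degree below m. Then p u = g - q w has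
degree at most m + r, and since p has degree exactly m, this bounds u. -/
theorem FormsCoprime.exists_mul_add_mul_of_coeff_ne_zero {F : Type*} [Field F] {m n r s : ℕ}
    {p q : F[X]} (h : FormsCoprime m n p q) (hc : p.coeff m ≠ 0) (hms : m ≤ s + 1)
    (hrs : m + r = n + s) {g : F[X]} (hg : g.natDegree ≤ m + r) :
    ∃ u w : F[X], u.natDegree ≤ r ∧ w.natDegree ≤ s ∧ p * u + q * w = g := by
  have hp0 : p ≠ 0 := fun h0 => hc (by simp [h0])
  have hdeg : p.natDegree = m := le_antisymm h.natDegree_left (le_natDegree_of_ne_zero hc)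
  obtain ⟨a, b, hab⟩ := h.isCoprime
  have hw : (g * b % p).natDegree ≤ s := by
    by_cases hz : g * b % p = 0
    · simp [hz]
    · have := natDegree_lt_natDegree hz (EuclideanDomain.mod_lt (g * b) hp0)
      omega
  have heq : p * (g * a + q * (g * b / p)) + q * (g * b % p) = g := by
    have h1 := EuclideanDomain.div_add_mod (g * b) p
    linear_combination g * hab + q * h1
  refine ⟨_, _, ?_, hw, heq⟩
  set u := g * a + q * (g * b / p)
  set w := g * b % p
  by_cases hu : u = 0
  · simp [hu]
  · have h2 : (p * u).natDegree ≤ m + r := by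
      rw [show p * u = g - q * w by rw [← heq]; ring]
      refine (natDegree_sub_le_of_le hg (natDegree_mul_le_of_le h.natDegree_right hw)).trans ?_
      omega
    rw [natDegree_mul hp0 hu] at h2
    omega

/-- At least one of the two forms does not vanish at infinity, so it attains its formal degree and
can serve as the divisor. -/
theorem FormsCoprime.exists_mul_add_mul {F : Type*} [Field F] {m n r s : ℕ}
    {p q : F[X]} (h : FormsCoprime m n p q) (hms : m ≤ s + 1) (hnr : n ≤ r + 1)
    (hrs : m + r = n + s) {g : F[X]} (hg : g.natDegree ≤ m + r) :
    ∃ u w : F[X], u.natDegree ≤ r ∧ w.natDegree ≤ s ∧ p * u + q * w = g := by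
  rcases h.coeff_ne_zero with hc | hc
  · exact h.exists_mul_add_mul_of_coeff_ne_zero hc hms hrs hg
  · obtain ⟨u, w, hu, hw, e⟩ :=
      h.symm.exists_mul_add_mul_of_coeff_ne_zero hc hnr hrs.symm (hrs ▸ hg)
    exact ⟨w, u, hw, hu, by rw [add_comm]; exact e⟩

/-- Removing the greatest common divisor of two binary forms. -/
theorem exists_formsCoprime {F : Type*} [Field F] {m n : ℕ} {p q : F[X]} (hp : p.natDegree ≤ m)
    (hq : q.natDegree ≤ n) (hmn : m ≤ n) (h0 : p ≠ 0) :
    ∃ (k a b : ℕ) (d p' q' : F[X]), k + a = m ∧ k + b = n ∧ d ≠ 0 ∧ d.natDegree ≤ k ∧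
      p = d * p' ∧ q = d * q' ∧ FormsCoprime a b p' q' := by
  classical
  set d := EuclideanDomain.gcd p q
  obtain ⟨p', hp'⟩ : d ∣ p := EuclideanDomain.gcd_dvd_left p q
  obtain ⟨q', hq'⟩ : d ∣ q := EuclideanDomain.gcd_dvd_right p q
  have hd : d ≠ 0 := fun h => h0 (by rw [hp', h, zero_mul])
  have hp'0 : p' ≠ 0 := fun h => h0 (by rw [hp', h, mul_zero])
  have hcop : IsCoprime p' q' := by
    refine ⟨EuclideanDomain.gcdA p q, EuclideanDomain.gcdB p q, mul_left_cancel₀ hd ?_⟩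
    have := EuclideanDomain.gcd_eq_gcd_ab p q
    change d = _ at this
    rw [mul_one]
    conv_rhs => rw [this]
    linear_combination (-EuclideanDomain.gcdA p q) * hp' - EuclideanDomain.gcdB p q * hq'
  have hdp : p.natDegree = d.natDegree + p'.natDegree := by
    conv_lhs => rw [hp', natDegree_mul hd hp'0]
  have hcp : p'.coeff p'.natDegree ≠ 0 := by simpa using hp'0
  -- The zero form vanishes to every order at infinity, so here the order of `p` alone counts; `hmn`
  -- keeps `n - k` from truncating.
  by_cases hq0 : q' = 0
  · refine ⟨m - p'.natDegree, p'.natDegree, n - (m - p'.natDegree), d, p', q', by omega, by omega,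
      hd, by omega, hp', hq', ⟨le_rfl, by simp [hq0], hcop, Or.inl hcp⟩⟩
  have hdq : q.natDegree = d.natDegree + q'.natDegree := by
    conv_lhs => rw [hq', natDegree_mul hd hq0]
  have hcq : q'.coeff q'.natDegree ≠ 0 := by simpa using hq0
  -- The polynomial gcd misses common zeros at infinity. Their multiplicity is the smaller of the
  -- two degree drops, and it is added to the degree of `d` to give `k`.
  rcases le_total (m - p.natDegree) (n - q.natDegree) with hle | hle
  · refine ⟨m - p'.natDegree, p'.natDegree, n - (m - p'.natDegree), d, p', q', by omega, by omega,
      hd, by omega, hp', hq', ⟨le_rfl, by omega, hcop, Or.inl hcp⟩⟩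
  · refine ⟨n - q'.natDegree, m - (n - q'.natDegree), q'.natDegree, d, p', q', by omega, by omega,
      hd, by omega, hp', hq', ⟨by omega, le_rfl, hcop, Or.inr hcq⟩⟩

/-! ### Absorbing the projectivity into the cubic frame. -/

/-- The third symmetric power of a `2 × 2` matrix. -/
def symCube {F : Type*} [Field F] (g : Matrix (Fin 2) (Fin 2) F) : Matrix (Fin 4) (Fin 4) F :=
  !![g 0 0 ^ 3, 3 * g 0 0 ^ 2 * g 0 1, 3 * g 0 0 * g 0 1 ^ 2, g 0 1 ^ 3;
    g 0 0 ^ 2 * g 1 0, g 0 0 ^ 2 * g 1 1 + 2 * g 0 0 * g 0 1 * g 1 0,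
      g 0 1 ^ 2 * g 1 0 + 2 * g 0 0 * g 0 1 * g 1 1, g 0 1 ^ 2 * g 1 1;
    g 0 0 * g 1 0 ^ 2, 2 * g 0 0 * g 1 0 * g 1 1 + g 0 1 * g 1 0 ^ 2,
      g 0 0 * g 1 1 ^ 2 + 2 * g 0 1 * g 1 0 * g 1 1, g 0 1 * g 1 1 ^ 2;
    g 1 0 ^ 3, 3 * g 1 0 ^ 2 * g 1 1, 3 * g 1 0 * g 1 1 ^ 2, g 1 1 ^ 3]

/-- Row j of `symCube g` lists the coefficients of (g₀₀ s + g₀₁ t)^(3-j) (g₁₀ s + g₁₁ t)^j. -/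
theorem symCube_mulVec_veroneseVec {F : Type*} [Field F] (g : Matrix (Fin 2) (Fin 2) F)
    (v : Fin 2 → F) :
    (symCube g).mulVec (veroneseVec 3 v) = veroneseVec 3 (g.mulVec v) := by
  ext j
  fin_cases j <;>
    simp [symCube, Matrix.mulVec, dotProduct, Fin.sum_univ_four, veroneseVec] <;> ring

/-- Symmetric cubes are multiplicative, and the cube of the scalar matrix det g is its third power.
This avoids dividing by the determinant. -/
theorem symCube_adjugate_mul {F : Type*} [Field F] (g : Matrix (Fin 2) (Fin 2) F) :
    symCube g.adjugate * symCube g = g.det ^ 3 • (1 : Matrix (Fin 4) (Fin 4) F) := by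
  ext i j
  fin_cases i <;> fin_cases j <;>
    simp [symCube, Matrix.mul_apply, Fin.sum_univ_four, Matrix.adjugate_fin_two,
      Matrix.det_fin_two] <;> ring

theorem symCube_mulVec_injective {F : Type*} [Field F] {g : Matrix (Fin 2) (Fin 2) F}
    (hg : g.det ≠ 0) : Function.Injective (symCube g).mulVec := by
  intro x y hxy
  have h := congrArg (symCube g.adjugate).mulVec hxy
  simp only [Matrix.mulVec_mulVec, symCube_adjugate_mul, Matrix.smul_mulVec, Matrix.one_mulVec] at h
  exact smul_right_injective _ (pow_ne_zero 3 hg) h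

theorem veronese_mk {F : Type*} [Field F] (r : ℕ) {v : Fin 2 → F} (hv : v ≠ 0) :
    veronese r (Projectivization.mk F v hv) =
      Projectivization.mk F (veroneseVec r v) (veroneseVec_ne_zero r hv) := rfl

/-- A point lies on the line spanned by two points iff its vectors are linear combinations. -/
theorem mk_mem_span_pair {F W : Type*} [Field F] [AddCommGroup W] [Module F W] {a b w : W}
    (ha : a ≠ 0) (hb : b ≠ 0) (hw : w ≠ 0) :
    Projectivization.mk F w hw ∈ Projectivization.Subspace.span
      {Projectivization.mk F a ha, Projectivization.mk F b hb} ↔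
      ∃ x y : F, x • a + y • b = w := by
  rw [← Submodule.mem_span_pair, ← Submodule.mk_mem_projectivization_iff _ hw]
  suffices h : Projectivization.Subspace.span
      {Projectivization.mk F a ha, Projectivization.mk F b hb} =
        (Submodule.span F {a, b}).projectivization by rw [h]
  apply le_antisymm
  · rw [Projectivization.Subspace.span_le_subspace_iff]
    rintro _ (rfl | rfl)
    · exact Submodule.subset_span (by simp)
    · exact Submodule.subset_span (by simp)
  · rw [OrderIso.symm_apply_le, Submodule.span_le]
    rintro _ (rfl | rfl)
    · exact (Projectivization.Subspace.mem_submodule_iff _ ha).2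
        (Projectivization.Subspace.subset_span _ (by simp))
    · exact (Projectivization.Subspace.mem_submodule_iff _ hb).2
        (Projectivization.Subspace.subset_span _ (by simp))

/-- After a change of the cubic frame, corresponding points have equal parameters. -/
theorem exists_adapted_cubicFrame {F : Type*} [Field F] (V : RuledQuintic F) :
    ∃ (M : (Fin 4 → F) →ₗ[F] (Fin 7 → F)) (hM : Function.Injective M),
      Disjoint (LinearMap.range V.conicFrame) (LinearMap.range M) ∧
      ∀ p, V.cubicPoint (V.projectivity • p) = Projectivization.map M hM (veronese 3 p) := by
  obtain ⟨g, hg⟩ : ∃ g : GL (Fin 2) F, V.projectivity = .mk g := by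
    obtain ⟨g, hg⟩ := QuotientGroup.mk_surjective V.projectivity
    exact ⟨g, hg.symm⟩
  have hdet : (g : Matrix (Fin 2) (Fin 2) F).det ≠ 0 :=
    ((Matrix.isUnit_iff_isUnit_det _).1 g.isUnit).ne_zero
  have hM : Function.Injective
      (V.cubicFrame ∘ₗ (symCube (g : Matrix (Fin 2) (Fin 2) F)).mulVecLin) :=
    V.cubicFrame_injective.comp (symCube_mulVec_injective hdet)
  refine ⟨_, hM, V.disjoint_frames.mono_right (LinearMap.range_comp_le_range _ _), ?_⟩
  refine Projectivization.ind fun v hv => ?_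
  rw [hg, Projectivization.PGL.mk_smul_mk, cubicPoint, veronese_mk, veronese_mk,
    Projectivization.map_mk, Projectivization.map_mk]
  congr 1
  rw [LinearMap.comp_apply, Matrix.mulVecLin_apply, symCube_mulVec_veroneseVec]
  rfl

/-! ### Linear forms and contractions. -/

/-- The polynomial of degree at most `n` whose coefficients are the values of a linear form. -/
def formPoly {F : Type*} [Field F] {n : ℕ} (l : (Fin (n + 1) → F) →ₗ[F] F) : F[X] :=
  ∑ i : Fin (n + 1), monomial (i : ℕ) (l (Pi.single i 1))

theorem natDegree_formPoly_le {F : Type*} [Field F] {n : ℕ} (l : (Fin (n + 1) → F) →ₗ[F] F) :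
    (formPoly l).natDegree ≤ n :=
  natDegree_sum_le_of_forall_le _ _ fun i _ =>
    (natDegree_monomial_le _).trans (Nat.le_of_lt_succ i.2)

theorem coeffPairing_formPoly {F : Type*} [Field F] {n : ℕ} (l : (Fin (n + 1) → F) →ₗ[F] F)
    (c : Fin (n + 1) → F) : coeffPairing c (formPoly l) = l c := by
  rw [formPoly, map_sum]
  conv_rhs => rw [pi_eq_sum_univ' c, map_sum]
  refine Finset.sum_congr rfl fun i _ => ?_
  rw [← mul_one (l (Pi.single i 1)), ← smul_eq_mul, ← smul_monomial, map_smul,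
    ← X_pow_eq_monomial, coeffPairing_X_pow, map_smul, smul_eq_mul, smul_eq_mul, mul_comm]

/-- The contraction of a vector of length `m + 1` with a form `p` to a vector of length `r + 1`. -/
def contraction {F : Type*} [Field F] (m r : ℕ) (p : F[X]) :
    (Fin (m + 1) → F) →ₗ[F] (Fin (r + 1) → F) where
  toFun c j := coeffPairing c (p * X ^ (j : ℕ))
  map_add' c c' := by
    ext j
    simp [coeffPairing_apply, mul_add, Finset.sum_add_distrib]
  map_smul' a c := by
    ext j
    simp only [coeffPairing_apply, Pi.smul_apply, smul_eq_mul, Finset.mul_sum, RingHom.id_apply]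
    exact Finset.sum_congr rfl fun i _ => by ring

/-- Pairing with a Veronese vector is evaluation, which is multiplicative: p X^j takes the value
p(v) times the j-th Veronese coordinate. -/
theorem contraction_veroneseVec {F : Type*} [Field F] {a r m : ℕ} (h : a + r = m) {p : F[X]}
    (hp : p.natDegree ≤ a) (v : Fin 2 → F) :
    contraction m r p (veroneseVec m v) = homEval a p v • veroneseVec r v := by
  subst h
  ext j
  change homEval (a + r) (p * X ^ (j : ℕ)) v = _
  rw [homEval_mul hp ((natDegree_X_pow_le _).trans (Nat.le_of_lt_succ j.2)),
    homEval, homEval, coeffPairing_X_pow, Pi.smul_apply, smul_eq_mul]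

theorem coeffPairing_mul_eq_zero {F : Type*} [Field F] {m r : ℕ} {p u : F[X]}
    {c : Fin (m + 1) → F} (hc : contraction m r p c = 0) (hu : u.natDegree ≤ r) :
    coeffPairing c (p * u) = 0 := by
  rw [u.as_sum_range' (r + 1) (Nat.lt_succ_of_le hu), Finset.mul_sum, map_sum]
  refine Finset.sum_eq_zero fun i hi => ?_
  have := congrFun hc ⟨i, Finset.mem_range.1 hi⟩
  change coeffPairing c (p * X ^ i) = 0 at this
  rw [← C_mul_X_pow_eq_monomial, mul_left_comm, ← smul_eq_C_mul, map_smul, this, smul_zero]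

/-- Coprime forms have no common kernel vector in sufficiently high degree. -/
theorem FormsCoprime.eq_zero_of_contraction {F : Type*} [Field F] {a b m r s : ℕ} {p q : F[X]}
    (h : FormsCoprime a b p q) (has : a ≤ s + 1) (hbr : b ≤ r + 1) (hr : a + r = m)
    (hs : b + s = m) {c : Fin (m + 1) → F} (hp : contraction m r p c = 0)
    (hq : contraction m s q c = 0) : c = 0 := by
  ext i
  -- The coordinate `c i` is the pairing with X^i, which decomposes as p u + q w; both terms pair to
  -- zero.
  obtain ⟨u, w, hu, hw, e⟩ := h.exists_mul_add_mul has hbr (hr.trans hs.symm)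
    (g := X ^ (i : ℕ)) ((natDegree_X_pow_le _).trans (by omega))
  rw [← coeffPairing_X_pow c i, ← e, map_add, coeffPairing_mul_eq_zero hp hu,
    coeffPairing_mul_eq_zero hq hw, add_zero, Pi.zero_apply]

theorem eq_zero_of_sub_eq_zero_of_disjoint {F W U X : Type*} [Field F] [AddCommGroup W] [Module F W]
    [AddCommGroup U] [Module F U] [AddCommGroup X] [Module F X] {A : W →ₗ[F] X} {B : U →ₗ[F] X}
    (hA : Function.Injective A) (hB : Function.Injective B)
    (hAB : Disjoint (LinearMap.range A) (LinearMap.range B)) {x : W} {y : U}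
    (h : A x - B y = 0) : x = 0 ∧ y = 0 := by
  have h1 : A x = B y := sub_eq_zero.1 h
  have h2 : A x = 0 := Submodule.disjoint_def.1 hAB _ ⟨x, rfl⟩ ⟨y, h1.symm⟩
  exact ⟨hA (by rw [h2, map_zero]), hB (by rw [← h1, h2, map_zero])⟩

/-! ### Hyperplane sections of the surface. -/

/-- A subspace of codimension one is the zero set of a nonzero linear form. -/
theorem exists_linearForm {F : Type*} [Field F] {S : PG6.Sub F} (hS : IsRSpace 5 S) :
    ∃ l : (Fin 7 → F) →ₗ[F] F, l ≠ 0 ∧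
      ∀ w (hw : w ≠ 0), Projectivization.mk F w hw ∈ S ↔ l w = 0 := by
  set T := Projectivization.Subspace.submodule S with hT
  have hT6 : Module.finrank F T = 6 := hS
  have hlt : T < ⊤ := by
    refine lt_top_iff_ne_top.2 fun h => ?_
    rw [h, finrank_top, Module.finrank_fin_fun] at hT6
    omega
  obtain ⟨l, hl0, hl⟩ := T.exists_le_ker_of_lt_top hlt
  have hker : Module.finrank F (LinearMap.ker l) = 6 := by
    have h1 := Module.Dual.finrank_ker_add_one_of_ne_zero (f := l) hl0
    rw [Module.finrank_fin_fun] at h1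
    omega
  have heq : T = LinearMap.ker l :=
    Submodule.eq_of_le_of_finrank_eq hl (hT6.trans hker.symm)
  refine ⟨l, hl0, fun w hw => ?_⟩
  rw [← Projectivization.Subspace.mem_submodule_iff S hw, ← hT, heq, LinearMap.mem_ker]

/-- An adapted cubic frame for `V`, so that corresponding points have equal parameters, together
with an equation of the hyperplane `S`. -/
structure SectionData {F : Type*} [Field F] (V : RuledQuintic F) (S : PG6.Sub F) where
  cubic : (Fin 4 → F) →ₗ[F] (Fin 7 → F)
  cubic_injective : Function.Injective cubic
  disjoint : Disjoint (LinearMap.range V.conicFrame) (LinearMap.range cubic)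
  cubicPoint_eq : ∀ p, V.cubicPoint (V.projectivity • p) =
    Projectivization.map cubic cubic_injective (veronese 3 p)
  form : (Fin 7 → F) →ₗ[F] F
  mem_iff : ∀ w (hw : w ≠ 0), Projectivization.mk F w hw ∈ S ↔ form w = 0

namespace SectionData

variable {F : Type*} [Field F] {V : RuledQuintic F} {S : PG6.Sub F}

/-- The restriction of the equation of the hyperplane to the conic. -/
def quadric (D : SectionData V S) : F[X] := formPoly (n := 2) (D.form ∘ₗ V.conicFrame)

/-- The restriction of the equation of the hyperplane to the twisted cubic. -/
def cubicForm (D : SectionData V S) : F[X] := formPoly (n := 3) (D.form ∘ₗ D.cubic)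

theorem form_conic (D : SectionData V S) (v : Fin 2 → F) :
    D.form (V.conicFrame (veroneseVec 2 v)) = homEval 2 D.quadric v :=
  (coeffPairing_formPoly (D.form ∘ₗ V.conicFrame) _).symm

theorem form_cubic (D : SectionData V S) (v : Fin 2 → F) :
    D.form (D.cubic (veroneseVec 3 v)) = homEval 3 D.cubicForm v :=
  (coeffPairing_formPoly (D.form ∘ₗ D.cubic) _).symm

theorem conic_ne_zero (V : RuledQuintic F) {v : Fin 2 → F} (hv : v ≠ 0) :
    V.conicFrame (veroneseVec 2 v) ≠ 0 :=
  (map_ne_zero_iff _ V.conicFrame_injective).2 (veroneseVec_ne_zero 2 hv)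

theorem cubic_ne_zero (D : SectionData V S) {v : Fin 2 → F} (hv : v ≠ 0) :
    D.cubic (veroneseVec 3 v) ≠ 0 :=
  (map_ne_zero_iff _ D.cubic_injective).2 (veroneseVec_ne_zero 3 hv)

theorem generator_mk (D : SectionData V S) {v : Fin 2 → F} (hv : v ≠ 0) :
    V.generator (Projectivization.mk F v hv) = Projectivization.Subspace.span
      {Projectivization.mk F _ (conic_ne_zero V hv),
        Projectivization.mk F _ (D.cubic_ne_zero hv)} := by
  rw [generator, D.cubicPoint_eq]
  rfl

theorem mk_mem_generator_iff (D : SectionData V S) {v : Fin 2 → F} (hv : v ≠ 0) {w : Fin 7 → F}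
    (hw : w ≠ 0) : Projectivization.mk F w hw ∈ V.generator (Projectivization.mk F v hv) ↔
      ∃ x y : F, x • V.conicFrame (veroneseVec 2 v) + y • D.cubic (veroneseVec 3 v) = w := by
  rw [D.generator_mk hv, mk_mem_span_pair]

theorem generator_le_iff (D : SectionData V S) {v : Fin 2 → F} (hv : v ≠ 0) :
    V.generator (Projectivization.mk F v hv) ≤ S ↔
      homEval 2 D.quadric v = 0 ∧ homEval 3 D.cubicForm v = 0 := by
  rw [D.generator_mk hv, Projectivization.Subspace.span_le_subspace_iff, Set.pair_subset_iff,
    SetLike.mem_coe, SetLike.mem_coe, D.mem_iff, D.mem_iff, D.form_conic, D.form_cubic]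

/-- Generators are counted as an image of the zeros of `d`, so an upper bound needs no injectivity
of the parametrisation. -/
theorem exists_encard_generatorsIn (D : SectionData V S) {k : ℕ} {d : F[X]} (hd : d ≠ 0)
    (hdk : d.natDegree ≤ k) (h : ∀ v : Fin 2 → F, v ≠ 0 → homEval 2 D.quadric v = 0 →
      homEval 3 D.cubicForm v = 0 → homEval k d v = 0) :
    ∃ i ≤ k, (V.generatorsIn S).encard = i := by
  have hle : (V.generatorsIn S).encard ≤ k := by
    refine (Set.encard_le_encard ?_).trans
      ((Set.encard_image_le V.generator _).trans (encard_zeros_le hdk hd))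
    rintro _ ⟨⟨p, rfl⟩, hp⟩
    rw [← p.mk_rep, D.generator_le_iff] at hp
    exact ⟨p, h _ p.rep_nonzero hp.1 hp.2, rfl⟩
  obtain ⟨i, hi, hik⟩ := ENat.le_natCast_iff.1 hle
  exact ⟨i, hik, hi⟩

theorem inter_points_eq (D : SectionData V S) {N : Set (PG6 F)} (hN : N ⊆ (S : Set (PG6 F)))
    (hNV : N ⊆ V.points)
    (h : ∀ (v : Fin 2 → F) (_ : v ≠ 0) (x y : F)
      (hw : x • V.conicFrame (veroneseVec 2 v) + y • D.cubic (veroneseVec 3 v) ≠ 0),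
      x * homEval 2 D.quadric v + y * homEval 3 D.cubicForm v = 0 →
      Projectivization.mk F _ hw ∈ N ∨
        (homEval 2 D.quadric v = 0 ∧ homEval 3 D.cubicForm v = 0)) :
    (S : Set (PG6 F)) ∩ V.points = N ∪ ⋃ l ∈ V.generatorsIn S, (l : Set (PG6 F)) := by
  apply Set.Subset.antisymm
  · rintro z ⟨hzS, hzV⟩
    obtain ⟨p, hp⟩ := Set.mem_iUnion.1 hzV
    induction z using Projectivization.ind with | h w hw =>
    induction p using Projectivization.ind with | h v hv =>
    obtain ⟨x, y, rfl⟩ := (D.mk_mem_generator_iff hv hw).1 hp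
    have hz := (D.mem_iff _ hw).1 hzS
    simp only [map_add, map_smul, D.form_conic, D.form_cubic, smul_eq_mul] at hz
    rcases h v hv x y hw hz with hzN | hzG
    · exact Or.inl hzN
    · exact Or.inr (Set.mem_biUnion ⟨⟨_, rfl⟩, (D.generator_le_iff hv).2 hzG⟩ hp)
  · refine Set.union_subset (Set.subset_inter hN hNV) (Set.iUnion₂_subset ?_)
    rintro _ ⟨⟨p, rfl⟩, hp⟩
    exact Set.subset_inter hp (Set.subset_iUnion (fun p => (V.generator p : Set (PG6 F))) p)

/-- A hyperplane containing the conic directrix. -/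
theorem meetsIn_conic (D : SectionData V S) (hf : D.quadric = 0) (hc : D.cubicForm ≠ 0) :
    ∃ i ≤ 3, V.MeetsIn S V.conic i := by
  have h0 : ∀ v, homEval 2 D.quadric v = 0 := fun v => by simp [homEval, hf]
  obtain ⟨i, hi, hcard⟩ := D.exists_encard_generatorsIn hc (natDegree_formPoly_le _)
    fun v _ _ h => h
  refine ⟨i, hi, hcard, D.inter_points_eq ?_ ?_ ?_⟩
  · rintro _ ⟨p, rfl⟩
    induction p using Projectivization.ind with | h v hv =>
    exact (D.mem_iff _ (conic_ne_zero V hv)).2 ((D.form_conic v).trans (h0 v))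
  · rintro _ ⟨p, rfl⟩
    exact Set.mem_iUnion.2 ⟨p, Projectivization.Subspace.subset_span _ (by simp)⟩
  · intro v hv x y hw hxy
    -- The relation reads y c(v) = 0: either the point is the conic point of its generator, or the
    -- whole generator lies in `S`.
    by_cases hy : y = 0
    · left
      refine ⟨Projectivization.mk F v hv, ?_⟩
      have hx : x ≠ 0 := by
        rintro rfl
        simp [hy] at hw
      rw [conicPoint, veronese_mk, Projectivization.map_mk, Projectivization.mk_eq_mk_iff']
      refine ⟨x⁻¹, ?_⟩
      rw [hy, zero_smul, add_zero, smul_smul, inv_mul_cancel₀ hx, one_smul]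
    · exact Or.inr ⟨h0 v, by simpa [h0, hy] using hxy⟩

/-- The parametrisation of the residual curve of a hyperplane section. -/
def residual (D : SectionData V S) (m : ℕ) (p q : F[X]) : (Fin (m + 1) → F) →ₗ[F] (Fin 7 → F) :=
  V.conicFrame ∘ₗ contraction m 2 q - D.cubic ∘ₗ contraction m 3 p

theorem residual_veroneseVec (D : SectionData V S) {a b m : ℕ} {p q : F[X]}
    (ha : a + 3 = m) (hb : b + 2 = m) (hp : p.natDegree ≤ a) (hq : q.natDegree ≤ b)
    (v : Fin 2 → F) : D.residual m p q (veroneseVec m v) =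
      homEval b q v • V.conicFrame (veroneseVec 2 v) -
        homEval a p v • D.cubic (veroneseVec 3 v) := by
  simp only [residual, LinearMap.sub_apply, LinearMap.comp_apply, contraction_veroneseVec ha hp,
    contraction_veroneseVec hb hq, map_smul]

/-- Disjointness of the frames makes both contractions of a kernel vector vanish separately, and
coprimality then kills the vector. -/
theorem residual_injective (D : SectionData V S) {a b m : ℕ} {p q : F[X]}
    (ha : a + 3 = m) (hb : b + 2 = m) (ha4 : a ≤ 2) (h : FormsCoprime a b p q) :
    Function.Injective (D.residual m p q) := by
  refine (injective_iff_map_eq_zero _).2 fun c hc => ?_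
  obtain ⟨h1, h2⟩ := eq_zero_of_sub_eq_zero_of_disjoint V.conicFrame_injective D.cubic_injective
    D.disjoint hc
  exact h.eq_zero_of_contraction (by omega) (by omega) ha hb h2 h1

/-- A hyperplane not containing the conic directrix. -/
theorem meetsIn_residual (D : SectionData V S) {k a b m : ℕ} {d p q : F[X]} (hka : k + a = 2)
    (hkb : k + b = 3) (hm : k + m = 5) (hd : d ≠ 0) (hdk : d.natDegree ≤ k)
    (hf : D.quadric = d * p) (hc : D.cubicForm = d * q) (h : FormsCoprime a b p q) :
    ∃ N, IsNRC m N ∧ ∃ i ≤ k, V.MeetsIn S N i := by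
  have hf' : ∀ v, homEval 2 D.quadric v = homEval k d v * homEval a p v := fun v => by
    rw [hf, ← hka, homEval_mul hdk h.natDegree_left]
  have hc' : ∀ v, homEval 3 D.cubicForm v = homEval k d v * homEval b q v := fun v => by
    rw [hc, ← hkb, homEval_mul hdk h.natDegree_right]
  have hinj : Function.Injective (D.residual m p q) :=
    D.residual_injective (by omega) (by omega) (by omega) h
  have hL := D.residual_veroneseVec (m := m) (by omega) (by omega) h.natDegree_left
    h.natDegree_right
  -- As p and q have no common zero, f and c vanish together only where d does.
  obtain ⟨i, hi, hcard⟩ := D.exists_encard_generatorsIn hd hdk fun v hv h1 h2 => by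
    by_contra hdv
    rw [hf', mul_eq_zero, or_iff_right hdv] at h1
    rw [hc', mul_eq_zero, or_iff_right hdv] at h2
    exact (h.homEval_ne_zero hv).elim (· h1) (· h2)
  refine ⟨_, ⟨D.residual m p q, hinj, rfl⟩, i, hi, hcard, D.inter_points_eq ?_ ?_ ?_⟩
  · rintro _ ⟨x, rfl⟩
    induction x using Projectivization.ind with | h v hv =>
    refine (D.mem_iff _ ((map_ne_zero_iff _ hinj).2 (veroneseVec_ne_zero m hv))).2 ?_
    rw [hL, map_sub, map_smul, map_smul, D.form_conic, D.form_cubic, hf', hc', smul_eq_mul,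
      smul_eq_mul]
    ring
  · rintro _ ⟨x, rfl⟩
    refine Set.mem_iUnion.2 ⟨x, ?_⟩
    induction x using Projectivization.ind with | h v hv =>
    refine (D.mk_mem_generator_iff hv
      ((map_ne_zero_iff _ hinj).2 (veroneseVec_ne_zero m hv))).2 ⟨homEval b q v, -homEval a p v, ?_⟩
    rw [hL, neg_smul, sub_eq_add_neg]
  · intro v hv x y hw hxy
    by_cases hdv : homEval k d v = 0
    · exact Or.inr ⟨by rw [hf', hdv, zero_mul], by rw [hc', hdv, zero_mul]⟩
    left
    refine ⟨Projectivization.mk F v hv, ?_⟩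
    have hxy' : x * homEval a p v + y * homEval b q v = 0 := by
      refine mul_left_cancel₀ hdv ?_
      rw [mul_zero, ← hxy, hf', hc']
      ring
    dsimp only
    rw [veronese_mk, Projectivization.map_mk, Projectivization.mk_eq_mk_iff']
    simp only [hL]
    -- Since x p(v) + y q(v) = 0 with p(v), q(v) not both zero, (x, y) is proportional to (q(v),
    -- -p(v)); the witness is the ratio.
    rcases h.homEval_ne_zero hv with hpv | hqv
    · have hy : y ≠ 0 := by
        rintro rfl
        have : x = 0 := by simpa [hpv] using hxy'
        simp [this] at hw
      refine ⟨-(homEval a p v / y), ?_⟩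
      have hx : x = -(y * homEval b q v) / homEval a p v := by
        field_simp
        linear_combination hxy'
      rw [hx, smul_add, smul_smul, smul_smul, sub_eq_add_neg, ← neg_smul]
      congr 2
      · field_simp
      · field_simp
    · have hx0 : x ≠ 0 := by
        rintro rfl
        have : y = 0 := by simpa [hqv] using hxy'
        simp [this] at hw
      refine ⟨homEval b q v / x, ?_⟩
      have hy : y = -(x * homEval a p v) / homEval b q v := by
        field_simp
        linear_combination hxy'
      rw [hy, smul_add, smul_smul, smul_smul, sub_eq_add_neg, ← neg_smul]
      congr 2
      · field_simp
      · field_simp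

/-- A hyperplane that contains the conic directrix does not contain the twisted cubic. -/
theorem cubicForm_ne_zero (D : SectionData V S) (hform : D.form ≠ 0) (hf : D.quadric = 0) :
    D.cubicForm ≠ 0 := by
  intro hc
  have h1 : ∀ c, D.form (V.conicFrame c) = 0 := fun c => by
    rw [← LinearMap.comp_apply, ← coeffPairing_formPoly (n := 2) (D.form ∘ₗ V.conicFrame)]
    exact (congrArg _ hf).trans (map_zero _)
  have h2 : ∀ c, D.form (D.cubic c) = 0 := fun c => by
    rw [← LinearMap.comp_apply, ← coeffPairing_formPoly (n := 3) (D.form ∘ₗ D.cubic)]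
    exact (congrArg _ hc).trans (map_zero _)
  -- Disjoint ranges of dimensions 3 and 4 fill the 7-dimensional space.
  have htop : LinearMap.range V.conicFrame ⊔ LinearMap.range D.cubic = ⊤ := by
    refine Submodule.eq_top_of_disjoint _ _ ?_ D.disjoint
    rw [LinearMap.finrank_range_of_inj V.conicFrame_injective,
      LinearMap.finrank_range_of_inj D.cubic_injective]
    simp
  refine hform (LinearMap.ker_eq_top.1 (top_le_iff.1 (htop ▸ sup_le ?_ ?_)))
  · rintro _ ⟨c, rfl⟩
    exact h1 c
  · rintro _ ⟨c, rfl⟩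
    exact h2 c

end SectionData

end RuledQuintic

end

theorem mainTheorem3 {F : Type*} [Field F] [Finite F] (hq : 6 ≤ Nat.card F)
    (V : RuledQuintic F) (S : PG6.Sub F) (hS : IsRSpace 5 S) :
    (∃ N, IsNRC 5 N ∧ V.MeetsIn S N 0) ∨
    (∃ N, IsNRC 4 N ∧ ∃ i ≤ 1, V.MeetsIn S N i) ∨
    (∃ N, IsNRC 3 N ∧ ∃ i ≤ 2, V.MeetsIn S N i) ∨
    (∃ i ≤ 3, V.MeetsIn S V.conic i) := by
  obtain ⟨M, hM, hdis, hpt⟩ := V.exists_adapted_cubicFrame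
  obtain ⟨l, hl0, hl⟩ := RuledQuintic.exists_linearForm hS
  let D : RuledQuintic.SectionData V S := ⟨M, hM, hdis, hpt, l, hl⟩
  by_cases hf : D.quadric = 0
  · exact Or.inr (Or.inr (Or.inr (D.meetsIn_conic hf (D.cubicForm_ne_zero hl0 hf))))
  obtain ⟨k, a, b, d, p, q, hka, hkb, hd, hdk, hp, hq', h⟩ :=
    RuledQuintic.exists_formsCoprime (RuledQuintic.natDegree_formPoly_le _)
      (RuledQuintic.natDegree_formPoly_le _) (by norm_num) hf (q := D.cubicForm)
  have hk : k ≤ 2 := by omega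
  interval_cases k
  · obtain ⟨N, hN, i, hi, hmeet⟩ := D.meetsIn_residual (m := 5) hka hkb rfl hd hdk hp hq' h
    obtain rfl : i = 0 := by omega
    exact Or.inl ⟨N, hN, hmeet⟩
  · exact Or.inr (Or.inl (D.meetsIn_residual (m := 4) hka hkb rfl hd hdk hp hq' h))
  · exact Or.inr (Or.inr (Or.inl (D.meetsIn_residual (m := 3) hka hkb rfl hd hdk hp hq' h)))
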